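/- All Lie algebras are real and finite-dimensional. A Lie algebra $\mathfrak g$ is \emph{unimodular} if $\operatorname{tr}(\operatorname{ad}_X)=0$ for all $X\in\mathfrak g$, and \emph{of type I} if for every $X\in\mathfrak g$ all complex eigenvalues of $\operatorname{ad}_X$ lie in $i\mathbb R$. For forms on $\mathfrak g$, $d$ is the Chevalley--Eilenberg differential, so $d\eta(X,Y)=-\eta([X,Y])$ for a $1$-form $\eta$; for an endomorphism $\varphi$ put $N_\varphi(X,Y)=[\varphi X,\varphi Y]+\varphi^2[X,Y]-\varphi([\varphi X,Y]+[X,\varphi Y])$. A \emph{Sasakian structure} on a Lie algebra is a quadruple $(\varphi,\xi,\eta,g)$ consisting of an endomorphism, a vector, a $1$-form and an inner product such that $\eta(\xi)=1$, $\varphi^2=-\mathrm{Id}+\eta\otimes\xi$, $g(\varphi X,\varphi Y)=g(X,Y)-\eta(X)\eta(Y)$, $d\eta(X,Y)=2g(\varphi X,Y)$ and $N_\varphi=-d\eta\otimes\xi$. A \emph{Vaisman structure} is a pair $(J,g)$ of a complex structure ($J^2=-\mathrm{Id}$, $N_J=0$) and an inner product with $g(JX,JY)=g(X,Y)$ for which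 $\omega=g(J\cdot,\cdot)$ satisfies $d\omega=\theta\wedge\omega$ for some nonzero closed $1$-form $\theta$ that is parallel for the Levi-Civita connection of $g$. \textbf{Corollary (Sasakian $\Rightarrow$ type I).} Let $\mathfrak s$ be a unimodular solvable Lie algebra admitting a Sasakian structure. Then $\mathfrak s$ is of type I. Moreover, $\mathfrak s$ is isomorphic to a subalgebra of a unimodular solvable Lie algebra $\mathfrak g$ with $\dim\mathfrak g=\dim\mathfrak s+1$ which admits a Vaisman structure, and $\mathfrak g$ is itself of type I. -/

import Mathlib

universe u

/-- A real Lie algebra is unimodular if every `ad x` is traceless. -/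
def IsUnimodular (L : Type u) [LieRing L] [LieAlgebra ℝ L] : Prop :=
  ∀ x : L, LinearMap.trace ℝ L (LieAlgebra.ad ℝ L x) = 0

/-- A real Lie algebra is of type I if, for every `x`, all the complex eigenvalues of `ad x`
(that is, the eigenvalues of its complexification) lie in `iℝ`. -/
def IsTypeI (L : Type u) [LieRing L] [LieAlgebra ℝ L] : Prop :=
  ∀ (x : L) (z : ℂ),
    Module.End.HasEigenvalue (LinearMap.baseChange ℂ (LieAlgebra.ad ℝ L x)) z → z.re = 0

/-- The Chevalley-Eilenberg differential of a `1`-form (trivial coefficients):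
`dη(x, y) = -η([x, y])`. -/
def dOneForm {L : Type u} [LieRing L] [LieAlgebra ℝ L] (η : L →ₗ[ℝ] ℝ) (x y : L) : ℝ :=
  -η ⁅x, y⁆

/-- The Chevalley-Eilenberg differential of a `2`-form (trivial coefficients):
`dω(x, y, z) = -ω([x, y], z) - ω([y, z], x) - ω([z, x], y)`. -/
def dTwoForm {L : Type u} [LieRing L] [LieAlgebra ℝ L] (ω : L →ₗ[ℝ] L →ₗ[ℝ] ℝ)
    (x y z : L) : ℝ :=
  -ω ⁅x, y⁆ z - ω ⁅y, z⁆ x - ω ⁅z, x⁆ y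

/-- The wedge product `θ ∧ ω` of a `1`-form and a `2`-form. -/
def wedgeOneTwo {L : Type u} [LieRing L] [LieAlgebra ℝ L] (θ : L →ₗ[ℝ] ℝ)
    (ω : L →ₗ[ℝ] L →ₗ[ℝ] ℝ) (x y z : L) : ℝ :=
  θ x * ω y z + θ y * ω z x + θ z * ω x y

/-- The Nijenhuis torsion of an endomorphism:
`N(x, y) = [φx, φy] + φ²[x, y] - φ([φx, y] + [x, φy])`. -/
def nijenhuis {L : Type u} [LieRing L] [LieAlgebra ℝ L] (φ : L →ₗ[ℝ] L) (x y : L) : L :=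
  ⁅φ x, φ y⁆ + φ (φ ⁅x, y⁆) - φ (⁅φ x, y⁆ + ⁅x, φ y⁆)

/-- An inner product on a real vector space, as a bilinear form. -/
structure IsInnerProduct {L : Type u} [LieRing L] [LieAlgebra ℝ L]
    (g : L →ₗ[ℝ] L →ₗ[ℝ] ℝ) : Prop where
  symm : ∀ x y, g x y = g y x
  pos : ∀ x, x ≠ 0 → 0 < g x x

/-- `nab` is the Levi-Civita connection of the inner product `g` on the Lie algebra `L`
(as an operator on left invariant vector fields): it is torsion free and metric. -/
structure IsLeviCivita {L : Type u} [LieRing L] [LieAlgebra ℝ L]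
    (g : L →ₗ[ℝ] L →ₗ[ℝ] ℝ) (nab : L →ₗ[ℝ] L →ₗ[ℝ] L) : Prop where
  torsion_free : ∀ x y, nab x y - nab y x = ⁅x, y⁆
  metric : ∀ x y z, g (nab x y) z + g y (nab x z) = 0

/-- A Sasakian structure `(φ, ξ, η, g)` on a real Lie algebra: an almost contact metric structure
which is contact metric (`dη = 2 g(φ·, ·)`) and normal (`N_φ = -dη ⊗ ξ`). -/
structure SasakianStructure (L : Type u) [LieRing L] [LieAlgebra ℝ L] where
  φ : L →ₗ[ℝ] L
  ξ : L
  η : L →ₗ[ℝ] ℝ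
  g : L →ₗ[ℝ] L →ₗ[ℝ] ℝ
  inner_g : IsInnerProduct g
  eta_xi : η ξ = 1
  phi_phi : ∀ x, φ (φ x) = -x + η x • ξ
  compatible : ∀ x y, g (φ x) (φ y) = g x y - η x * η y
  contact : ∀ x y, dOneForm η x y = 2 * g (φ x) y
  normal : ∀ x y, nijenhuis φ x y = -(dOneForm η x y • ξ)

/-- A Vaisman structure on a real Lie algebra: an integrable complex structure `J` with a Hermitian
inner product `g` whose fundamental form `ω = g(J·, ·)` satisfies `dω = θ ∧ ω` for a nonzero closed
`1`-form `θ` (the Lee form) which is parallel for the Levi-Civita connection of `g`. -/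
structure VaismanStructure (L : Type u) [LieRing L] [LieAlgebra ℝ L] where
  J : L →ₗ[ℝ] L
  g : L →ₗ[ℝ] L →ₗ[ℝ] ℝ
  θ : L →ₗ[ℝ] ℝ
  inner_g : IsInnerProduct g
  J_J : ∀ x, J (J x) = -x
  integrable : ∀ x y, nijenhuis J x y = 0
  hermitian : ∀ x y, g (J x) (J y) = g x y
  theta_ne_zero : θ ≠ 0
  closed : ∀ x y, dOneForm θ x y = 0
  lck : ∀ x y z, dTwoForm (g ∘ₗ J) x y z = wedgeOneTwo θ (g ∘ₗ J) x y z
  -- parallel: `(∇ₓθ)(y) = -θ(∇ₓy) = 0` for left invariant `x`, `y`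
  parallel : ∃ nab : L →ₗ[ℝ] L →ₗ[ℝ] L, IsLeviCivita g nab ∧ ∀ x y, θ (nab x y) = 0

/-! The Reeb vector ξ turns out to be central, so the quotient by ℝξ is a unimodular solvable Kähler
algebra, and the spectrum of ad can be read off there: a central extension adds only the eigenvalue
0. For centrality, `xi_mem_bracketSpan` puts ξ in the derived algebra (outside dimension one). By
Lie's theorem such elements act nilpotently, so tr (ad ξ)² = 0; since ad ξ is skew, it vanishes.

On a unimodular Kähler algebra the Bianchi identity turns the scalar curvature into a trace governed
by ∑ [eᵢ, Jeᵢ], which is 0, so the scalar curvature vanishes (`IsKahler.sum_nab_nab`). It also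
equals -¼ ∑ |[eᵢ, eⱼ]|² - ½ ∑ tr (ad eᵢ)². In the solvable case the second sum runs only over
directions orthogonal to the derived algebra, and a regrouping in the style of Milnor makes the
whole minus a sum of squares. Hence every ad x is skew on the derived algebra. Eigenvectors with
nonzero eigenvalue lie in its complexification, so all eigenvalues are imaginary.

The Vaisman algebra is the product with a line, on which J exchanges ξ with the new direction;
centrality of ξ makes J integrable. -/

/-- The vectors of `b` are orthonormal for the bilinear form `g`. -/
def IsOrthonormalFor {L ι : Type*} [AddCommGroup L] [Module ℝ L] [DecidableEq ι]
    (g : L →ₗ[ℝ] L →ₗ[ℝ] ℝ) (b : Module.Basis ι ℝ L) : Prop :=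
  ∀ i j, g (b i) (b j) = if i = j then 1 else 0

namespace IsOrthonormalFor

variable {L ι : Type*} [AddCommGroup L] [Module ℝ L] [DecidableEq ι] [Fintype ι]
  {g : L →ₗ[ℝ] L →ₗ[ℝ] ℝ} {b : Module.Basis ι ℝ L}

theorem repr_eq (hb : IsOrthonormalFor g b) (x : L) (i : ι) : b.repr x i = g x (b i) := by
  conv_rhs => rw [← b.sum_repr x, map_sum, LinearMap.sum_apply]
  simp only [map_smul, LinearMap.smul_apply, hb _ _, smul_eq_mul, mul_ite, mul_one, mul_zero]
  simp

theorem sum_smul (hb : IsOrthonormalFor g b) (x : L) : ∑ i, g x (b i) • b i = x := by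
  conv_rhs => rw [← b.sum_repr x]
  simp [hb.repr_eq]

theorem trace_eq (hb : IsOrthonormalFor g b) (f : L →ₗ[ℝ] L) :
    LinearMap.trace ℝ L f = ∑ i, g (f (b i)) (b i) := by
  rw [LinearMap.trace_eq_matrix_trace ℝ b, Matrix.trace]
  simp [LinearMap.toMatrix_apply, hb.repr_eq]

theorem sum_mul (hb : IsOrthonormalFor g b) (x y : L) :
    ∑ i, g x (b i) * g (b i) y = g x y := by
  conv_rhs => rw [← hb.sum_smul x]
  simp

theorem ext (hb : IsOrthonormalFor g b) {x y : L} (h : ∀ z, g x z = g y z) : x = y := by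
  rw [← hb.sum_smul x, ← hb.sum_smul y]
  simp [h]

/-- In a contraction over an orthonormal basis an operator moves to the other slot as its
adjoint. -/
theorem sum_adjoint (hb : IsOrthonormalFor g b) (F : L →ₗ[ℝ] L →ₗ[ℝ] ℝ) {f f' : L →ₗ[ℝ] L}
    (hs : ∀ x y, g x y = g y x) (hf : ∀ x y, g (f x) y = g x (f' y)) :
    ∑ i, F (f (b i)) (b i) = ∑ i, F (b i) (f' (b i)) := by
  have h1 : ∀ i, F (f (b i)) (b i) = ∑ k, g (f (b i)) (b k) * F (b k) (b i) := fun i => by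
    conv_lhs => rw [← hb.sum_smul (f (b i))]
    simp
  have h2 : ∀ k, F (b k) (f' (b k)) = ∑ i, g (f (b i)) (b k) * F (b k) (b i) := fun k => by
    conv_lhs => rw [← hb.sum_smul (f' (b k))]
    simp [hf, hs (f' (b k))]
  simp_rw [h1, h2]
  exact Finset.sum_comm

end IsOrthonormalFor

theorem IsInnerProduct.self_nonneg {L : Type u} [LieRing L] [LieAlgebra ℝ L]
    {g : L →ₗ[ℝ] L →ₗ[ℝ] ℝ} (hg : IsInnerProduct g) (x : L) : 0 ≤ g x x := by
  by_cases h : x = 0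
  · simp [h]
  · exact (hg.pos x h).le

theorem IsInnerProduct.eq_zero_of_self {L : Type u} [LieRing L] [LieAlgebra ℝ L]
    {g : L →ₗ[ℝ] L →ₗ[ℝ] ℝ} (hg : IsInnerProduct g) {x : L} (h : g x x = 0) : x = 0 := by
  by_contra hx
  exact (hg.pos x hx).ne' h

/-- For every subspace `N` there is an orthonormal basis each vector of which is in `N` or
orthogonal to `N`. -/
theorem IsInnerProduct.exists_basis {L : Type u} [LieRing L] [LieAlgebra ℝ L]
    [FiniteDimensional ℝ L] {g : L →ₗ[ℝ] L →ₗ[ℝ] ℝ} (hg : IsInnerProduct g)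
    (N : Submodule ℝ L) :
    ∃ (ι : Type u) (_ : Fintype ι) (_ : DecidableEq ι) (b : Module.Basis ι ℝ L),
      IsOrthonormalFor g b ∧ ∀ i, b i ∈ N ∨ ∀ y ∈ N, g (b i) y = 0 := by
  classical
  let core : InnerProductSpace.Core ℝ L :=
    { inner := fun x y => g x y
      conj_inner_symm := fun x y => by simpa using hg.symm y x
      re_inner_nonneg := fun x => by simpa using hg.self_nonneg x
      add_left := by simp
      smul_left := by simp
      definite := fun x hx => hg.eq_zero_of_self hx }
  let _ : NormedAddCommGroup L := core.toNormedAddCommGroup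
  let _ : InnerProductSpace ℝ L := InnerProductSpace.ofCore core.toCore
  have hin : ∀ x y : L, inner ℝ x y = g x y := fun _ _ => rfl
  let v := stdOrthonormalBasis ℝ N
  have hv : Orthonormal ℝ (fun i => (v i : L)) := v.orthonormal.comp_linearIsometry N.subtypeₗᵢ
  obtain ⟨u, b, hu, hb⟩ := hv.toSubtypeRange.exists_orthonormalBasis_extension
  refine ⟨u, inferInstance, inferInstance, b.toBasis, fun i j => ?_, fun i => ?_⟩
  · rw [← hin, b.coe_toBasis]
    exact orthonormal_iff_ite.mp b.orthonormal i j
  · rw [b.coe_toBasis]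
    by_cases hi : (i : L) ∈ Set.range fun i => (v i : L)
    · left
      obtain ⟨k, hk⟩ := hi
      rw [hb, ← hk]
      exact (v k).2
    · right
      intro y hy
      have : (⟨y, hy⟩ : N) = ∑ k, inner ℝ (v k) ⟨y, hy⟩ • v k := (v.sum_repr' _).symm
      have hy' : y = ∑ k, inner ℝ (v k) (⟨y, hy⟩ : N) • (v k : L) := by
        simpa using congrArg N.subtype this
      rw [hy', map_sum]
      refine Finset.sum_eq_zero fun k _ => ?_
      have hk : (v k : L) ∈ u := hu ⟨k, rfl⟩
      have h0 : inner ℝ (b i) (b ⟨v k, hk⟩) = 0 := by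
        rw [orthonormal_iff_ite.mp b.orthonormal, if_neg]
        rintro rfl
        exact hi ⟨k, rfl⟩
      have h1 : b ⟨v k, hk⟩ = v k := by rw [hb]
      rw [h1, hin] at h0
      simp [h0]

/-! ### Lie's theorem and nilpotency of the derived algebra -/

/-- The subspace spanned by all brackets. -/
def bracketSpan (K L : Type*) [CommRing K] [LieRing L] [LieAlgebra K L] : Submodule K L :=
  Submodule.span K {z | ∃ x y : L, ⁅x, y⁆ = z}

theorem lie_mem_bracketSpan (K : Type*) {L : Type*} [CommRing K] [LieRing L] [LieAlgebra K L]
    (x y : L) : ⁅x, y⁆ ∈ bracketSpan K L :=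
  Submodule.subset_span ⟨x, y, rfl⟩

/-- An element killed by every character of a solvable Lie algebra acts nilpotently on
finite-dimensional modules. -/
theorem isNilpotent_toEnd_of_character_eq_zero {K L : Type*} [Field K] [CharZero K] [IsAlgClosed K]
    [LieRing L] [LieAlgebra K L] [FiniteDimensional K L] [LieAlgebra.IsSolvable L] (x : L)
    (hx : ∀ χ : L →ₗ[K] K, (∀ a b : L, χ ⁅a, b⁆ = 0) → χ x = 0) (n : ℕ)
    (V : Type*) [AddCommGroup V] [Module K V] [LieRingModule L V] [LieModule K L V]
    [FiniteDimensional K V] (hn : Module.finrank K V = n) :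
    IsNilpotent (LieModule.toEnd K L V x) := by
  induction n using Nat.strong_induction_on generalizing V with
  | _ n ih =>
  rcases subsingleton_or_nontrivial V with hV | hV
  · exact ⟨1, LinearMap.ext fun v => Subsingleton.elim _ _⟩
  -- Lie's theorem gives a common eigenvector; its weight is a character, so `x` kills it, and
  -- induction applies to the quotient by its line.
  obtain ⟨χ, hχ⟩ := LieModule.exists_nontrivial_weightSpace_of_isSolvable K L V
  obtain ⟨⟨v, hv⟩, hv0⟩ := exists_ne (0 : LieModule.weightSpace V χ)
  have hv0 : v ≠ 0 := by simpa using hv0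
  rw [LieModule.mem_weightSpace] at hv
  have hxv : ⁅x, v⁆ = 0 := by
    rw [hv, hx χ, zero_smul]
    intro a c
    have h : ⁅⁅a, c⁆, v⁆ = 0 := by
      rw [lie_lie, hv, hv, lie_smul, lie_smul, hv, hv, smul_smul, smul_smul, mul_comm, sub_self]
    rw [hv] at h
    exact (smul_eq_zero.mp h).resolve_right hv0
  let W : LieSubmodule K L V :=
    { toSubmodule := K ∙ v
      lie_mem := by
        intro y m hm
        obtain ⟨c, rfl⟩ := Submodule.mem_span_singleton.mp hm
        rw [lie_smul, hv]
        exact Submodule.smul_mem _ _ (Submodule.smul_mem _ _ (Submodule.mem_span_singleton_self v)) }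
  have hdim : Module.finrank K (V ⧸ W) < n := by
    have h1 := W.toSubmodule.finrank_quotient_add_finrank
    have h2 : Module.finrank K W.toSubmodule = 1 := finrank_span_singleton hv0
    have h3 : Module.finrank K (V ⧸ W) = Module.finrank K (V ⧸ W.toSubmodule) := rfl
    omega
  have : FiniteDimensional K (V ⧸ W) :=
    inferInstanceAs (FiniteDimensional K (V ⧸ W.toSubmodule))
  obtain ⟨m, hm⟩ := ih _ hdim (V ⧸ W) rfl
  -- The `m`-th power maps into the line of `v`; one more factor kills it.
  refine ⟨m + 1, LinearMap.ext fun w => ?_⟩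
  have key : ∀ k : ℕ, LieSubmodule.Quotient.mk' W ((LieModule.toEnd K L V x ^ k) w) =
      (LieModule.toEnd K L (V ⧸ W) x ^ k) (LieSubmodule.Quotient.mk' W w) := by
    intro k
    induction k with
    | zero => rfl
    | succ k ihk =>
      rw [pow_succ', pow_succ', Module.End.mul_apply, Module.End.mul_apply, ← ihk]
      simp only [LieModule.toEnd_apply_apply, LieModuleHom.map_lie]
  have h1 := key m
  rw [hm, LinearMap.zero_apply] at h1
  have h2 : (LieModule.toEnd K L V x ^ m) w ∈ W := by
    rwa [LieSubmodule.Quotient.mk_eq_zero] at h1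
  obtain ⟨c, hc⟩ := Submodule.mem_span_singleton.mp h2
  rw [pow_succ', Module.End.mul_apply, ← hc]
  simp [hxv]

-- After complexification every character kills `1 ⊗ x`, so `ad x` becomes nilpotent; the trace
-- commutes with base change.
open scoped TensorProduct in
theorem trace_ad_comp_ad_eq_zero {L : Type*} [LieRing L] [LieAlgebra ℝ L]
    [FiniteDimensional ℝ L] [LieAlgebra.IsSolvable L] {x : L} (hx : x ∈ bracketSpan ℝ L) :
    LinearMap.trace ℝ L (LieAlgebra.ad ℝ L x ∘ₗ LieAlgebra.ad ℝ L x) = 0 := by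
  have : LieAlgebra.IsSolvable (ℂ ⊗[ℝ] L) :=
    (LieAlgebra.isSolvable_tensorProduct_iff (A := ℂ) (R := ℝ) (L := L)).mpr inferInstance
  have h : IsNilpotent (LieModule.toEnd ℂ (ℂ ⊗[ℝ] L) (ℂ ⊗[ℝ] L) ((1 : ℂ) ⊗ₜ[ℝ] x)) := by
    refine isNilpotent_toEnd_of_character_eq_zero _ (fun χ hχ => ?_) _ _ rfl
    induction hx using Submodule.span_induction with
    | mem z hz =>
      obtain ⟨a, c, rfl⟩ := hz
      have := hχ ((1 : ℂ) ⊗ₜ[ℝ] a) ((1 : ℂ) ⊗ₜ[ℝ] c)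
      simpa using this
    | zero => simp
    | add y z _ _ hy hz => rw [TensorProduct.tmul_add, map_add, hy, hz, add_zero]
    | smul r y _ hy =>
      have : (1 : ℂ) ⊗ₜ[ℝ] (r • y) = (r : ℂ) • ((1 : ℂ) ⊗ₜ[ℝ] y) := by
        rw [TensorProduct.tmul_smul, TensorProduct.smul_tmul', TensorProduct.smul_tmul']
        simp
      rw [this, map_smul, hy, smul_zero]
  have h1 : LieModule.toEnd ℂ (ℂ ⊗[ℝ] L) (ℂ ⊗[ℝ] L) ((1 : ℂ) ⊗ₜ[ℝ] x) =
      (LieAlgebra.ad ℝ L x).baseChange ℂ := by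
    ext y
    simp
  rw [h1] at h
  have h2 : LinearMap.trace ℂ (ℂ ⊗[ℝ] L)
      ((LieAlgebra.ad ℝ L x).baseChange ℂ ∘ₗ (LieAlgebra.ad ℝ L x).baseChange ℂ) = 0 := by
    have := LinearMap.isNilpotent_trace_of_isNilpotent (h.pow_succ 1)
    rw [pow_two] at this
    exact this.eq_zero
  rw [← LinearMap.baseChange_comp, LinearMap.trace_baseChange] at h2
  simpa using h2

open scoped TensorProduct in
/-- A complex eigenvector of `f` amounts to a pair of real vectors. -/
theorem exists_real_of_hasEigenvalue {V : Type*} [AddCommGroup V] [Module ℝ V]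
    {f : V →ₗ[ℝ] V} {z : ℂ} (h : Module.End.HasEigenvalue (f.baseChange ℂ) z) :
    ∃ u w : V, (u ≠ 0 ∨ w ≠ 0) ∧ f u = z.re • u - z.im • w ∧ f w = z.im • u + z.re • w := by
  obtain ⟨v, hv⟩ := h.exists_hasEigenvector
  let e := TensorProduct.equivFinsuppOfBasisLeft (M := ℂ) (N := V) Complex.basisOneI
  have hex : ∀ v : ℂ ⊗[ℝ] V, ∃ u w : V, v = (1 : ℂ) ⊗ₜ[ℝ] u + Complex.I ⊗ₜ[ℝ] w := by
    intro v
    induction v with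
    | zero => exact ⟨0, 0, by simp⟩
    | add a c ha hc =>
      obtain ⟨u, w, rfl⟩ := ha
      obtain ⟨u', w', rfl⟩ := hc
      exact ⟨u + u', w + w', by simp only [TensorProduct.tmul_add]; abel⟩
    | tmul c y =>
      refine ⟨c.re • y, c.im • y, ?_⟩
      rw [TensorProduct.tmul_smul, TensorProduct.smul_tmul', TensorProduct.tmul_smul,
        TensorProduct.smul_tmul', ← TensorProduct.add_tmul]
      congr 1
      apply Complex.ext <;> simp
  have hinj : ∀ u w u' w' : V, (1 : ℂ) ⊗ₜ[ℝ] u + Complex.I ⊗ₜ[ℝ] w =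
      (1 : ℂ) ⊗ₜ[ℝ] u' + Complex.I ⊗ₜ[ℝ] w' → u = u' ∧ w = w' := by
    intro u w u' w' h
    have h' := congrArg e h
    constructor
    · have := congrArg (fun F => F 0) h'
      simpa [e] using this
    · have := congrArg (fun F => F 1) h'
      simpa [e] using this
  obtain ⟨u, w, rfl⟩ := hex v
  have h1 := hv.apply_eq_smul
  have h2 : z • ((1 : ℂ) ⊗ₜ[ℝ] u + Complex.I ⊗ₜ[ℝ] w) =
      (1 : ℂ) ⊗ₜ[ℝ] (z.re • u - z.im • w) + Complex.I ⊗ₜ[ℝ] (z.im • u + z.re • w) := by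
    have hz : z = (z.re : ℂ) + z.im * Complex.I := (Complex.re_add_im z).symm
    have e1 : z • ((1 : ℂ) ⊗ₜ[ℝ] u) =
        (1 : ℂ) ⊗ₜ[ℝ] (z.re • u) + Complex.I ⊗ₜ[ℝ] (z.im • u) := by
      rw [TensorProduct.tmul_smul, TensorProduct.smul_tmul', TensorProduct.tmul_smul,
        TensorProduct.smul_tmul', TensorProduct.smul_tmul', ← TensorProduct.add_tmul]
      congr 1
      apply Complex.ext <;> simp
    have e2 : z • (Complex.I ⊗ₜ[ℝ] w) =
        -((1 : ℂ) ⊗ₜ[ℝ] (z.im • w)) + Complex.I ⊗ₜ[ℝ] (z.re • w) := by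
      rw [TensorProduct.tmul_smul, TensorProduct.smul_tmul', TensorProduct.tmul_smul,
        TensorProduct.smul_tmul', TensorProduct.smul_tmul', ← TensorProduct.neg_tmul,
        ← TensorProduct.add_tmul]
      congr 1
      apply Complex.ext <;> simp
    rw [smul_add, e1, e2, TensorProduct.tmul_sub, TensorProduct.tmul_add]
    abel
  rw [h2, map_add, LinearMap.baseChange_tmul, LinearMap.baseChange_tmul] at h1
  refine ⟨u, w, ?_, hinj _ _ _ _ h1⟩
  by_contra hc
  push Not at hc
  exact hv.2 (by simp [hc.1, hc.2])

/-! ### Levi-Civita connection and Kähler algebras -/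

section LeviCivita

variable {L : Type u} [LieRing L] [LieAlgebra ℝ L] {g : L →ₗ[ℝ] L →ₗ[ℝ] ℝ}

/-- The right hand side of the Koszul formula. -/
def koszulForm (g : L →ₗ[ℝ] L →ₗ[ℝ] ℝ) (x y z : L) : ℝ :=
  g ⁅x, y⁆ z - g ⁅y, z⁆ x + g ⁅z, x⁆ y

theorem IsInnerProduct.exists_leviCivita [FiniteDimensional ℝ L] (hg : IsInnerProduct g) :
    ∃ nab : L →ₗ[ℝ] L →ₗ[ℝ] L, IsLeviCivita g nab ∧
      ∀ x y z, 2 * g (nab x y) z = koszulForm g x y z := by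
  obtain ⟨ι, _, _, b, hb, -⟩ := hg.exists_basis ⊤
  let nab : L →ₗ[ℝ] L →ₗ[ℝ] L := LinearMap.mk₂ ℝ
    (fun x y => ∑ i, (koszulForm g x y (b i) / 2) • b i)
    (fun x x' y => by
      rw [← Finset.sum_add_distrib]
      refine Finset.sum_congr rfl fun i _ => ?_
      rw [← add_smul]
      congr 1
      simp only [koszulForm, add_lie, lie_add, map_add, LinearMap.add_apply]
      ring)
    (fun c x y => by
      rw [Finset.smul_sum]
      refine Finset.sum_congr rfl fun i _ => ?_
      rw [smul_smul]
      congr 1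
      simp only [koszulForm, smul_lie, lie_smul, map_smul, LinearMap.smul_apply, smul_eq_mul]
      ring)
    (fun x y y' => by
      rw [← Finset.sum_add_distrib]
      refine Finset.sum_congr rfl fun i _ => ?_
      rw [← add_smul]
      congr 1
      simp only [koszulForm, add_lie, lie_add, map_add, LinearMap.add_apply]
      ring)
    (fun c x y => by
      rw [Finset.smul_sum]
      refine Finset.sum_congr rfl fun i _ => ?_
      rw [smul_smul]
      congr 1
      simp only [koszulForm, smul_lie, lie_smul, map_smul, LinearMap.smul_apply, smul_eq_mul]
      ring)
  have hnab : ∀ x y z, 2 * g (nab x y) z = koszulForm g x y z := by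
    intro x y z
    have hz : koszulForm g x y z = ∑ i, g z (b i) * koszulForm g x y (b i) := by
      conv_lhs => rw [← hb.sum_smul z]
      simp only [koszulForm, map_sum, map_smul, lie_sum, sum_lie, smul_lie, lie_smul,
        LinearMap.sum_apply, LinearMap.smul_apply, smul_eq_mul, mul_add, mul_sub,
        Finset.sum_add_distrib, Finset.sum_sub_distrib]
    have hn : nab x y = ∑ i, (koszulForm g x y (b i) / 2) • b i := rfl
    rw [hn, hz, map_sum, LinearMap.sum_apply, Finset.mul_sum]
    refine Finset.sum_congr rfl fun i _ => ?_
    rw [map_smul, LinearMap.smul_apply, smul_eq_mul, hg.symm (b i) z]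
    ring
  refine ⟨nab, ⟨fun x y => hb.ext fun z => ?_, fun x y z => ?_⟩, hnab⟩
  · have h1 := hnab x y z
    have h2 := hnab y x z
    rw [map_sub, LinearMap.sub_apply]
    simp only [koszulForm] at h1 h2
    rw [← lie_skew y x, ← lie_skew x z, ← lie_skew z y] at h2
    simp only [map_neg, LinearMap.neg_apply] at h2
    linarith
  · have h1 := hnab x y z
    have h2 := hnab x z y
    rw [hg.symm y]
    simp only [koszulForm] at h1 h2
    rw [← lie_skew z y, ← lie_skew x z, ← lie_skew y x] at h2
    simp only [map_neg, LinearMap.neg_apply] at h2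
    linarith

/-- A Kähler structure on a Lie algebra. -/
structure IsKahler (g : L →ₗ[ℝ] L →ₗ[ℝ] ℝ) (J : L →ₗ[ℝ] L) : Prop where
  inner_g : IsInnerProduct g
  J_J : ∀ x, J (J x) = -x
  hermitian : ∀ x y, g (J x) (J y) = g x y
  integrable : ∀ x y, nijenhuis J x y = 0
  closed : ∀ x y z, dTwoForm (g ∘ₗ J) x y z = 0

namespace IsKahler

variable {J : L →ₗ[ℝ] L}

theorem skew (h : IsKahler g J) (x y : L) : g (J x) y = -g x (J y) := by
  have := h.hermitian x (J y)
  rw [h.J_J, map_neg] at this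
  linarith

/-- The classical formula for ∇J: Koszul's formula, combined with dω at (x, y, z) and (x, Jy, Jz)
and with N_J(y, z) paired with Jx. -/
theorem exists_parallel [FiniteDimensional ℝ L] (h : IsKahler g J) :
    ∃ nab : L →ₗ[ℝ] L →ₗ[ℝ] L, IsLeviCivita g nab ∧ ∀ x y, nab x (J y) = J (nab x y) := by
  obtain ⟨nab, hn, hk⟩ := h.inner_g.exists_leviCivita
  obtain ⟨ι, _, _, b, hb, -⟩ := h.inner_g.exists_basis ⊤
  refine ⟨nab, hn, fun x y => hb.ext fun z => ?_⟩
  have h1 := hk x (J y) z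
  have h2 := hk x y (J z)
  have h3 := h.closed x y z
  have h4 := h.closed x (J y) (J z)
  have h5 : g (nijenhuis J y z) (J x) = 0 := by rw [h.integrable]; simp
  simp only [koszulForm] at h1 h2
  simp only [dTwoForm, LinearMap.comp_apply, h.skew, h.J_J, map_neg] at h3 h4
  simp only [nijenhuis, h.J_J, map_add, map_sub, map_neg, LinearMap.add_apply,
    LinearMap.sub_apply, LinearMap.neg_apply, h.hermitian] at h5
  rw [h.skew]
  linarith

end IsKahler

end LeviCivita

/-! ### Scalar curvature of unimodular Kähler algebras -/

section Curvature

variable {L : Type u} [LieRing L] [LieAlgebra ℝ L] {g : L →ₗ[ℝ] L →ₗ[ℝ] ℝ}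
  {nab : L →ₗ[ℝ] L →ₗ[ℝ] L}

/-- The curvature operator of a connection. -/
def curvature (nab : L →ₗ[ℝ] L →ₗ[ℝ] L) (x y : L) : L →ₗ[ℝ] L :=
  nab x ∘ₗ nab y - nab y ∘ₗ nab x - nab ⁅x, y⁆

theorem curvature_apply (x y z : L) :
    curvature nab x y z = nab x (nab y z) - nab y (nab x z) - nab ⁅x, y⁆ z := rfl

namespace IsLeviCivita

theorem skew (hn : IsLeviCivita g nab) (x y z : L) : g (nab x y) z = -g y (nab x z) := by
  linarith [hn.metric x y z]

theorem bianchi (hn : IsLeviCivita g nab) (x y z : L) :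
    curvature nab x y z + curvature nab y z x + curvature nab z x y = 0 := by
  have h1 : ∀ a b, nab a b = ⁅a, b⁆ + nab b a := fun a b => by rw [← hn.torsion_free]; abel
  simp only [curvature_apply]
  rw [h1 ⁅x, y⁆ z, h1 ⁅y, z⁆ x, h1 ⁅z, x⁆ y]
  simp only [← hn.torsion_free x y, ← hn.torsion_free y z, ← hn.torsion_free z x, map_sub]
  simp only [hn.torsion_free]
  have j : ⁅⁅x, y⁆, z⁆ + ⁅⁅y, z⁆, x⁆ + ⁅⁅z, x⁆, y⁆ = 0 := by
    have := lie_jacobi x y z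
    rw [← lie_skew x ⁅y, z⁆, ← lie_skew y ⁅z, x⁆, ← lie_skew z ⁅x, y⁆] at this
    have h := congrArg Neg.neg this
    rw [neg_zero] at h
    rw [← h]
    abel
  rw [← neg_eq_zero, ← j]
  abel

variable {ι : Type*} [Fintype ι] [DecidableEq ι] {b : Module.Basis ι ℝ L}

/-- On a unimodular Lie algebra invariant vector fields are divergence free. -/
theorem sum_nab_self (hn : IsLeviCivita g nab) (hg : IsInnerProduct g)
    (hb : IsOrthonormalFor g b) (hu : IsUnimodular L) : ∑ i, nab (b i) (b i) = 0 := by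
  refine hb.ext fun w => ?_
  have h1 := hu w
  rw [hb.trace_eq] at h1
  have h2 : ∀ i, g (nab w (b i)) (b i) = 0 := fun i => by
    have := hn.metric w (b i) (b i)
    rw [hg.symm (b i)] at this
    linarith
  simp only [LieAlgebra.ad_apply, ← hn.torsion_free, map_sub, LinearMap.sub_apply, h2, zero_sub,
    Finset.sum_neg_distrib, neg_eq_zero] at h1
  rw [map_sum, LinearMap.sum_apply, map_zero, LinearMap.zero_apply, ← neg_eq_zero, ← h1,
    ← Finset.sum_neg_distrib]
  refine Finset.sum_congr rfl fun i _ => ?_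
  rw [hn.skew, neg_neg, hg.symm]

/-- Each `nab (b j)` is skew, so it can be moved to the other slot of the contraction over `i`. -/
theorem sum_nab_nab_left (hn : IsLeviCivita g nab) (hg : IsInnerProduct g)
    (hb : IsOrthonormalFor g b) :
    ∑ i, ∑ j, g (nab (nab (b j) (b i)) (b i)) (b j) =
      ∑ i, ∑ j, g (nab (b i) (b j)) (nab (b j) (b i)) := by
  rw [Finset.sum_comm, Finset.sum_comm (γ := ι) (f := fun i j => g (nab (b i) (b j)) _)]
  refine Finset.sum_congr rfl fun j _ => ?_
  have := hb.sum_adjoint (F := (nab.compr₂ (g.flip (b j)))) (f := nab (b j)) (f' := -nab (b j))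
    hg.symm (fun x y => by rw [hn.skew, LinearMap.neg_apply, map_neg])
  simp only [LinearMap.compr₂_apply, LinearMap.flip_apply, LinearMap.neg_apply, map_neg] at this
  rw [this]
  refine Finset.sum_congr rfl fun i _ => ?_
  rw [hn.skew, neg_neg, hg.symm]

theorem sum_nab_nab_right (hn : IsLeviCivita g nab) (hg : IsInnerProduct g)
    (hb : IsOrthonormalFor g b) :
    ∑ i, ∑ j, g (b i) (nab (nab (b i) (b j)) (b j)) =
      ∑ i, ∑ j, g (nab (b i) (b j)) (nab (b j) (b i)) := by
  rw [← hn.sum_nab_nab_left hg hb, Finset.sum_comm]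
  refine Finset.sum_congr rfl fun j _ => Finset.sum_congr rfl fun i _ => ?_
  rw [hg.symm]

/-- The scalar curvature of a unimodular Lie algebra in terms of the connection. -/
theorem sum_curvature (hn : IsLeviCivita g nab) (hg : IsInnerProduct g)
    (hb : IsOrthonormalFor g b) (hu : IsUnimodular L) :
    ∑ i, ∑ j, g (curvature nab (b j) (b i) (b i)) (b j) =
      -∑ i, ∑ j, g (nab (b i) (b j)) (nab (b j) (b i)) := by
  have h0 : ∑ i, ∑ j, g (nab (b j) (nab (b i) (b i))) (b j) = 0 := by
    rw [Finset.sum_comm]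
    refine Finset.sum_eq_zero fun j _ => ?_
    have := congrArg (fun v => g (nab (b j) v) (b j)) (hn.sum_nab_self hg hb hu)
    simpa only [map_sum, LinearMap.sum_apply, map_zero, LinearMap.zero_apply] using this
  have h1 := hn.sum_nab_nab_left hg hb
  have h2 := hn.sum_nab_nab_right hg hb
  have h3 : ∀ i j, g (curvature nab (b j) (b i) (b i)) (b j) =
      g (nab (b j) (nab (b i) (b i))) (b j) + g (nab (b i) (b j)) (nab (b j) (b i))
      - g (nab (nab (b j) (b i)) (b i)) (b j) - g (b i) (nab (nab (b i) (b j)) (b j)) := by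
    intro i j
    rw [curvature_apply, ← hn.torsion_free]
    simp only [map_sub, LinearMap.sub_apply]
    rw [hn.skew (b i) (nab (b j) (b i)), hn.skew (nab (b i) (b j)), hg.symm (nab (b i) (b j))]
    ring
  simp only [h3, Finset.sum_sub_distrib, Finset.sum_add_distrib, h0, h1, h2]
  ring

/-- The sum of the squared norms of the brackets and the traces of `ad²`, in terms of the
connection. -/
theorem sum_lie_add_trace (hn : IsLeviCivita g nab) (hg : IsInnerProduct g)
    (hb : IsOrthonormalFor g b) :
    ∑ i, ∑ j, (g ⁅b i, b j⁆ ⁅b i, b j⁆ + 2 * g ⁅b i, ⁅b i, b j⁆⁆ (b j)) =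
      4 * ∑ i, ∑ j, g (nab (b i) (b j)) (nab (b j) (b i)) := by
  have h1 := hn.sum_nab_nab_left hg hb
  have h2 := hn.sum_nab_nab_right hg hb
  have h4 : ∑ i, ∑ j, g (nab (b j) (b i)) (nab (b j) (b i)) =
      ∑ i, ∑ j, g (nab (b i) (b j)) (nab (b i) (b j)) := Finset.sum_comm
  have h3 : ∀ i j, g ⁅b i, b j⁆ ⁅b i, b j⁆ + 2 * g ⁅b i, ⁅b i, b j⁆⁆ (b j) =
      g (nab (b j) (b i)) (nab (b j) (b i)) - g (nab (b i) (b j)) (nab (b i) (b j))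
      + 2 * g (b i) (nab (nab (b i) (b j)) (b j))
      + 2 * g (nab (nab (b j) (b i)) (b i)) (b j) := by
    intro i j
    have e : g ⁅b i, ⁅b i, b j⁆⁆ (b j) = -g ⁅b i, b j⁆ (nab (b i) (b j)) +
        g (b i) (nab ⁅b i, b j⁆ (b j)) := by
      rw [← hn.torsion_free (b i) ⁅b i, b j⁆, map_sub, LinearMap.sub_apply, hn.skew, hn.skew]
      ring
    rw [e, ← hn.torsion_free]
    simp only [map_sub, LinearMap.sub_apply]
    rw [hn.skew (nab (b j) (b i)), hg.symm (nab (b j) (b i)) (nab (b i) (b j))]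
    ring
  simp only [h3, Finset.sum_sub_distrib, Finset.sum_add_distrib, ← Finset.mul_sum, h1, h2, h4]
  ring

end IsLeviCivita

namespace IsKahler

variable {J : L →ₗ[ℝ] L} {ι : Type*} [Fintype ι] [DecidableEq ι] {b : Module.Basis ι ℝ L}

/-- By torsion-freeness this is ∑ ∇_{eᵢ}Jeᵢ - ∑ ∇_{Jeᵢ}eᵢ. The first sum is J applied to ∑ ∇_{eᵢ}eᵢ
= 0, and skewness of J makes the second its negative. -/
theorem sum_lie_J (h : IsKahler g J) (hn : IsLeviCivita g nab)
    (hJ : ∀ x y, nab x (J y) = J (nab x y)) (hb : IsOrthonormalFor g b) (hu : IsUnimodular L) :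
    ∑ i, ⁅b i, J (b i)⁆ = 0 := by
  have h0 := hn.sum_nab_self h.inner_g hb hu
  have h1 : ∑ i, nab (b i) (J (b i)) = 0 := by
    simp only [hJ, ← map_sum, h0, map_zero]
  have h2 : ∑ i, nab (J (b i)) (b i) = 0 := by
    refine hb.ext fun w => ?_
    have := hb.sum_adjoint (F := (nab.compr₂ (g.flip w))) (f := J) (f' := -J)
      h.inner_g.symm (fun x y => by rw [h.skew, LinearMap.neg_apply, map_neg])
    simp only [LinearMap.compr₂_apply, LinearMap.flip_apply, LinearMap.neg_apply, map_neg] at this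
    rw [map_sum, LinearMap.sum_apply, this, Finset.sum_neg_distrib, ← LinearMap.sum_apply,
      ← map_sum, h1]
    simp
  simp only [← hn.torsion_free, Finset.sum_sub_distrib, h1, h2, sub_zero]

/-- The sum is minus the scalar curvature, which Bianchi and J-invariance relate to the contraction
`h0` of R(eᵢ, Jeᵢ) with J. -/
theorem sum_nab_nab [FiniteDimensional ℝ L] (h : IsKahler g J) (hn : IsLeviCivita g nab)
    (hJ : ∀ x y, nab x (J y) = J (nab x y)) (hb : IsOrthonormalFor g b) (hu : IsUnimodular L) :
    ∑ i, ∑ j, g (nab (b i) (b j)) (nab (b j) (b i)) = 0 := by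
  have hJR : ∀ x y z, curvature nab x y (J z) = J (curvature nab x y z) := fun x y z => by
    simp only [curvature_apply, hJ, map_sub]
  have hanti : ∀ x y z, curvature nab x y z = -curvature nab y x z := fun x y z => by
    simp only [curvature_apply]
    rw [← lie_skew x y, map_neg, LinearMap.neg_apply]
    abel
  -- The commutator of `nab x` and `nab y` drops out of the trace against J, since both commute with
  -- J; only `nab ⁅x, y⁆` survives.
  have htr : ∀ x y, ∑ j, g (curvature nab x y (b j)) (J (b j)) =
      -∑ j, g (nab ⁅x, y⁆ (b j)) (J (b j)) := by
    intro x y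
    have e : ∀ f : L →ₗ[ℝ] L, ∑ j, g (f (b j)) (J (b j)) = -LinearMap.trace ℝ L (J ∘ₗ f) := by
      intro f
      rw [hb.trace_eq, ← Finset.sum_neg_distrib]
      refine Finset.sum_congr rfl fun j _ => ?_
      rw [LinearMap.comp_apply, h.skew, neg_neg]
    have hc : ∀ x, nab x ∘ₗ J = J ∘ₗ nab x := fun x => LinearMap.ext fun y => hJ x y
    have c : LinearMap.trace ℝ L (J ∘ₗ (nab x ∘ₗ nab y)) =
        LinearMap.trace ℝ L (J ∘ₗ (nab y ∘ₗ nab x)) := by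
      rw [← LinearMap.comp_assoc, ← hc, LinearMap.comp_assoc, LinearMap.trace_comp_comm',
        LinearMap.comp_assoc]
    rw [e, e, curvature, LinearMap.comp_sub, LinearMap.comp_sub, map_sub, map_sub, c]
    ring
  have h0 : ∑ i, ∑ j, g (curvature nab (b i) (J (b i)) (b j)) (J (b j)) = 0 := by
    simp only [htr, Finset.sum_neg_distrib]
    rw [Finset.sum_comm, neg_eq_zero]
    refine Finset.sum_eq_zero fun j _ => ?_
    have := congrArg (fun v => g (nab v (b j)) (J (b j))) (h.sum_lie_J hn hJ hb hu)
    simpa only [map_sum, LinearMap.sum_apply, map_zero, LinearMap.zero_apply] using this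
  have h1 : ∀ j, ∑ i, g (curvature nab (J (b i)) (b j) (b i)) (J (b j)) =
      ∑ i, g (curvature nab (b j) (b i) (b i)) (b j) := by
    intro j
    have := hb.sum_adjoint (F := LinearMap.mk₂ ℝ
      (fun x y => g (curvature nab x (b j) y) (J (b j)))
      (fun x x' y => by
        simp only [curvature_apply, map_add, add_lie, map_sub, LinearMap.add_apply,
          LinearMap.sub_apply]
        ring)
      (fun c x y => by
        simp only [curvature_apply, map_smul, smul_lie, map_sub, LinearMap.smul_apply,
          LinearMap.sub_apply, smul_eq_mul]
        ring)
      (fun x y y' => by simp only [map_add, LinearMap.add_apply])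
      (fun c x y => by simp only [map_smul, LinearMap.smul_apply])) (f := J) (f' := -J)
      h.inner_g.symm (fun x y => by rw [h.skew, LinearMap.neg_apply, map_neg])
    simp only [LinearMap.mk₂_apply, LinearMap.neg_apply, map_neg, hJR, h.hermitian] at this
    rw [this]
    refine Finset.sum_congr rfl fun i _ => ?_
    rw [hanti, map_neg, LinearMap.neg_apply, neg_neg]
  have h2 : ∀ i j, g (curvature nab (b i) (J (b i)) (b j)) (J (b j)) =
      -g (curvature nab (J (b i)) (b j) (b i)) (J (b j)) -
        g (curvature nab (b j) (b i) (b i)) (b j) := by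
    intro i j
    have := congrArg (fun v => g v (J (b j))) (hn.bianchi (b i) (J (b i)) (b j))
    simp only [map_add, LinearMap.add_apply, map_zero, LinearMap.zero_apply, hJR,
      h.hermitian] at this
    linarith
  have h3 := hn.sum_curvature h.inner_g hb hu
  have h4 : ∑ i, ∑ j, g (curvature nab (J (b i)) (b j) (b i)) (J (b j)) =
      ∑ i, ∑ j, g (curvature nab (b j) (b i) (b i)) (b j) := by
    rw [Finset.sum_comm, Finset.sum_congr rfl fun j _ => h1 j, Finset.sum_comm]
  simp only [h2, Finset.sum_sub_distrib, Finset.sum_neg_distrib, h4, h3] at h0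
  linarith

/-- On a unimodular Kähler Lie algebra the scalar curvature vanishes. -/
theorem sum_lie_add_trace [FiniteDimensional ℝ L] (h : IsKahler g J)
    (hb : IsOrthonormalFor g b) (hu : IsUnimodular L) :
    ∑ i, ∑ j, (g ⁅b i, b j⁆ ⁅b i, b j⁆ + 2 * g ⁅b i, ⁅b i, b j⁆⁆ (b j)) = 0 := by
  obtain ⟨nab, hn, hJ⟩ := h.exists_parallel
  rw [hn.sum_lie_add_trace h.inner_g hb, h.sum_nab_nab hn hJ hb hu, mul_zero]

end IsKahler

end Curvature

/-! ### Skewness of ad on the derived algebra -/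

section Milnor

variable {L : Type u} [LieRing L] [LieAlgebra ℝ L] {g : L →ₗ[ℝ] L →ₗ[ℝ] ℝ}

/-- Structure constants antisymmetric in `i, j`, with weights `a i ∈ {0, 1}` that kill the last
index, and with nonpositive total weight: the symmetric part of each `c i` with `a i = 1`, and each
`c i j` with `a i = a j`, vanish. -/
theorem eq_zero_of_sum_structure_constants {ι : Type*} [Fintype ι] (c : ι → ι → ι → ℝ)
    (a : ι → ℝ) (ha : ∀ i, a i = 0 ∨ a i = 1) (hc : ∀ i j k, c j i k = -c i j k)
    (hk : ∀ i j k, c i j k * a k = 0)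
    (h : ∑ i, ∑ j, ∑ k, (c i j k ^ 2 + 2 * (a i * (c i j k * c i k j))) = 0) (i j k : ι) :
    a i * (1 - a j) * (1 - a k) * (c i j k + c i k j) ^ 2 +
      (a i * a j + (1 - a i) * (1 - a j)) * c i j k ^ 2 = 0 := by
  set T : ι → ι → ι → ℝ := fun i j k => a i * (1 - a j) * (1 - a k) * (c i j k + c i k j) ^ 2 +
      (a i * a j + (1 - a i) * (1 - a j)) * c i j k ^ 2 with hT
  -- `V` redistributes the mixed squares, with one of `i`, `j` of weight 1: they complete 2 c_{ijk}
  -- c_{ikj} to a square, and the correction cancels in the total sum.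
  set V : ι → ι → ι → ℝ := fun i j k => a i * (1 - a j) * c i j k ^ 2 with hV
  have h1 : ∀ i j k, T i j k =
      (c i j k ^ 2 + 2 * (a i * (c i j k * c i k j))) + V i k j - V j i k := by
    intro i j k
    simp only [hT, hV, hc i j k]
    have e1 := hk i j k
    have e2 := hk i k j
    rcases ha k with h | h <;> rcases ha j with h' | h' <;> simp only [h, h', mul_one] at e1 e2 ⊢
    · ring
    · rw [e2]; ring
    · rw [e1]; ring
    · rw [e1, e2]; ring
  have h2 : ∑ i, ∑ j, ∑ k, V i k j = ∑ i, ∑ j, ∑ k, V i j k :=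
    Finset.sum_congr rfl fun i _ => Finset.sum_comm
  have h3 : ∑ i, ∑ j, ∑ k, V j i k = ∑ i, ∑ j, ∑ k, V i j k := Finset.sum_comm
  have h4 : ∑ i, ∑ j, ∑ k, T i j k = 0 := by
    simp only [h1, Finset.sum_sub_distrib, Finset.sum_add_distrib, h2, h3] at h ⊢
    linarith
  have h5 : ∀ i j k, 0 ≤ T i j k := by
    intro i j k
    simp only [hT]
    rcases ha i with h | h <;> rcases ha j with h' | h' <;> rcases ha k with h'' | h'' <;>
      simp only [h, h', h''] <;> norm_num <;> positivity
  have h6 := (Finset.sum_eq_zero_iff_of_nonneg fun i _ => Finset.sum_nonneg fun j _ =>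
    Finset.sum_nonneg fun k _ => h5 i j k).mp h4 i (Finset.mem_univ _)
  have h7 := (Finset.sum_eq_zero_iff_of_nonneg fun j _ =>
    Finset.sum_nonneg fun k _ => h5 i j k).mp h6 j (Finset.mem_univ _)
  exact (Finset.sum_eq_zero_iff_of_nonneg fun k _ => h5 i j k).mp h7 k (Finset.mem_univ _)

/-- On a solvable unimodular Kähler Lie algebra every `ad x` is skew on the derived algebra. -/
theorem IsKahler.lie_apply_self_eq_zero [FiniteDimensional ℝ L] [LieAlgebra.IsSolvable L]
    {J : L →ₗ[ℝ] L} (h : IsKahler g J) (hu : IsUnimodular L) (x : L) {u : L}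
    (hmem : u ∈ bracketSpan ℝ L) : g ⁅x, u⁆ u = 0 := by
  classical
  obtain ⟨ι, _, _, b, hb, hN⟩ := h.inner_g.exists_basis (bracketSpan ℝ L)
  have hS := h.sum_lie_add_trace hb hu
  let c : ι → ι → ι → ℝ := fun i j k => g ⁅b i, b j⁆ (b k)
  -- Weight 1 marks the basis vectors orthogonal to the derived algebra.
  let a : ι → ℝ := fun i => if b i ∈ bracketSpan ℝ L then 0 else 1
  have ha : ∀ i, a i = 0 ∨ a i = 1 := fun i => by
    by_cases hi : b i ∈ bracketSpan ℝ L <;> simp [a, hi]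
  have hperp : ∀ i, ∀ y ∈ bracketSpan ℝ L, g y (b i) * a i = 0 := by
    intro i y hy
    rcases hN i with hi | hi
    · simp [a, hi]
    · rw [h.inner_g.symm, hi y hy, zero_mul]
  have hsq : ∀ i j, g ⁅b i, b j⁆ ⁅b i, b j⁆ = ∑ k, c i j k ^ 2 := by
    intro i j
    rw [← hb.sum_mul]
    refine Finset.sum_congr rfl fun k _ => ?_
    rw [h.inner_g.symm (b k), pow_two]
  have hcc : ∀ i j, g ⁅b i, ⁅b i, b j⁆⁆ (b j) = ∑ k, c i j k * c i k j := by
    intro i j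
    conv_lhs => rw [← hb.sum_smul ⁅b i, b j⁆]
    simp [c, lie_sum]
  have htr : ∀ i, ∑ j, ∑ k, c i j k * c i k j = a i * ∑ j, ∑ k, c i j k * c i k j := by
    intro i
    by_cases hi : b i ∈ bracketSpan ℝ L
    · have := trace_ad_comp_ad_eq_zero hi
      rw [hb.trace_eq] at this
      simp only [LinearMap.comp_apply, LieAlgebra.ad_apply, hcc] at this
      rw [this, mul_zero]
    · simp [a, hi]
  have hsum : ∑ i, ∑ j, ∑ k, (c i j k ^ 2 + 2 * (a i * (c i j k * c i k j))) = 0 := by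
    simp only [hsq, hcc, Finset.sum_add_distrib, ← Finset.mul_sum] at hS ⊢
    rw [← hS]
    congr 2
    exact Finset.sum_congr rfl fun i _ => (htr i).symm
  have key := eq_zero_of_sum_structure_constants c a ha
    (fun i j k => by simp only [c]; rw [← lie_skew, map_neg, LinearMap.neg_apply])
    (fun i j k => hperp k _ (lie_mem_bracketSpan ℝ _ _)) hsum
  -- For `a i = 1` this is the vanishing square; for `a i = 0` the constants vanish individually,
  -- hence the use of `key` in both orders.
  have hsym : ∀ i j k, (1 - a j) * (1 - a k) * (c i j k + c i k j) = 0 := by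
    intro i j k
    have k1 := key i j k
    have k2 := key i k j
    rcases ha i with h | h <;> rcases ha j with h' | h' <;> rcases ha k with h'' | h'' <;>
      simp_all
  have hzero : ∀ i, g ⁅b i, u⁆ u = 0 := by
    intro i
    have e1 : g ⁅b i, u⁆ u = ∑ j, ∑ k, g u (b j) * g u (b k) * c i j k := by
      conv_lhs => rw [← hb.sum_smul u]
      simp only [lie_sum, lie_smul, map_sum, map_smul, LinearMap.sum_apply,
        LinearMap.smul_apply, smul_eq_mul, c, Finset.mul_sum]
      rw [Finset.sum_comm]
      refine Finset.sum_congr rfl fun j _ => Finset.sum_congr rfl fun k _ => ?_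
      ring
    have e2 : g ⁅b i, u⁆ u = ∑ j, ∑ k, g u (b j) * g u (b k) * c i k j := by
      rw [e1, Finset.sum_comm]
      refine Finset.sum_congr rfl fun j _ => Finset.sum_congr rfl fun k _ => ?_
      ring
    have e3 : g ⁅b i, u⁆ u + g ⁅b i, u⁆ u = 0 := by
      conv_lhs => rw [e1]; arg 2; rw [← e1, e2]
      simp only [← Finset.sum_add_distrib]
      refine Finset.sum_eq_zero fun j _ => Finset.sum_eq_zero fun k _ => ?_
      have p1 := hperp j u hmem
      have p2 := hperp k u hmem
      have p3 := hsym i j k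
      linear_combination g u (b j) * g u (b k) * p3 +
        g u (b k) * (c i j k + c i k j) * p1 +
        (1 - a j) * g u (b j) * (c i j k + c i k j) * p2
    linarith
  rw [← hb.sum_smul x]
  simp [sum_lie, hzero]

end Milnor

/-! ### Imaginary spectrum, quotients and central extensions -/

/-- If `f u = a u - b w` and `f w = b u + a w` with `u`, `w` not both zero, then `a = 0`: a real
form of the statement that the eigenvalues of `f` are imaginary. -/
def HasImaginarySpectrum {V : Type*} [AddCommGroup V] [Module ℝ V] (f : V →ₗ[ℝ] V) : Prop :=
  ∀ (a b : ℝ) (u w : V), f u = a • u - b • w → f w = b • u + a • w → a ≠ 0 → u = 0 ∧ w = 0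

theorem isTypeI_of_hasImaginarySpectrum {L : Type u} [LieRing L] [LieAlgebra ℝ L]
    (h : ∀ x : L, HasImaginarySpectrum (LieAlgebra.ad ℝ L x)) : IsTypeI L := by
  intro x z hz
  obtain ⟨u, w, h0, h1, h2⟩ := exists_real_of_hasEigenvalue hz
  by_contra ha
  obtain ⟨rfl, rfl⟩ := h x z.re z.im u w h1 h2 ha
  simp at h0

theorem mem_of_rotation {V : Type*} [AddCommGroup V] [Module ℝ V] (N : Submodule ℝ V) {a b : ℝ}
    (ha : a ≠ 0) {u w : V} (h1 : a • u - b • w ∈ N) (h2 : b • u + a • w ∈ N) :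
    u ∈ N ∧ w ∈ N := by
  have h0 : a ^ 2 + b ^ 2 ≠ 0 := by positivity
  constructor
  · have : (a ^ 2 + b ^ 2) • u ∈ N := by
      convert N.add_mem (N.smul_mem a h1) (N.smul_mem b h2) using 1
      module
    exact (N.smul_mem_iff h0).mp this
  · have : (a ^ 2 + b ^ 2) • w ∈ N := by
      convert N.sub_mem (N.smul_mem a h2) (N.smul_mem b h1) using 1
      module
    exact (N.smul_mem_iff h0).mp this

/-- The pair lies in the derived algebra, where `ad x` is skew: adding the two vanishing pairings
gives a (|u|² + |w|²) = 0. -/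
theorem IsKahler.hasImaginarySpectrum {L : Type u} [LieRing L] [LieAlgebra ℝ L]
    [FiniteDimensional ℝ L] [LieAlgebra.IsSolvable L] {g : L →ₗ[ℝ] L →ₗ[ℝ] ℝ} {J : L →ₗ[ℝ] L}
    (h : IsKahler g J) (hu : IsUnimodular L) (x : L) :
    HasImaginarySpectrum (LieAlgebra.ad ℝ L x) := by
  intro a b u w h1 h2 ha
  rw [LieAlgebra.ad_apply] at h1 h2
  obtain ⟨mu, mw⟩ := mem_of_rotation (bracketSpan ℝ L) ha (h1 ▸ lie_mem_bracketSpan ℝ x u)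
    (h2 ▸ lie_mem_bracketSpan ℝ x w)
  have e1 := h.lie_apply_self_eq_zero hu x mu
  have e2 := h.lie_apply_self_eq_zero hu x mw
  rw [h1] at e1
  rw [h2] at e2
  simp only [map_sub, map_add, map_smul, LinearMap.sub_apply, LinearMap.add_apply,
    LinearMap.smul_apply, smul_eq_mul] at e1 e2
  rw [h.inner_g.symm w u] at e1
  have hs : g u u + g w w = 0 := by
    have : a * (g u u + g w w) = 0 := by linarith
    exact (mul_eq_zero.mp this).resolve_left ha
  exact ⟨h.inner_g.eq_zero_of_self
      (by linarith [h.inner_g.self_nonneg u, h.inner_g.self_nonneg w]),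
    h.inner_g.eq_zero_of_self (by linarith [h.inner_g.self_nonneg u, h.inner_g.self_nonneg w])⟩

/-- The spectrum of `ad` does not change under a central extension, up to the eigenvalue `0`. -/
theorem hasImaginarySpectrum_of_hom {L L' : Type*} [LieRing L] [LieAlgebra ℝ L]
    [LieRing L'] [LieAlgebra ℝ L'] (π : L →ₗ⁅ℝ⁆ L') (hπ : ∀ v, π v = 0 → ∀ x : L, ⁅x, v⁆ = 0)
    (h : ∀ x, HasImaginarySpectrum (LieAlgebra.ad ℝ L' x)) (x : L) :
    HasImaginarySpectrum (LieAlgebra.ad ℝ L x) := by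
  intro a b u w h1 h2 ha
  rw [LieAlgebra.ad_apply] at h1 h2
  obtain ⟨hu, hw⟩ := h (π x) a b (π u) (π w)
    (by rw [LieAlgebra.ad_apply, ← LieHom.map_lie, h1, map_sub, map_smul, map_smul])
    (by rw [LieAlgebra.ad_apply, ← LieHom.map_lie, h2, map_add, map_smul, map_smul]) ha
  rw [hπ u hu] at h1
  rw [hπ w hw] at h2
  exact mem_of_rotation (⊥ : Submodule ℝ L) ha h1.symm h2.symm

/-- Unimodularity passes to quotients by central ideals. -/
theorem IsUnimodular.of_surjective {L L' : Type u} [LieRing L] [LieAlgebra ℝ L]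
    [LieRing L'] [LieAlgebra ℝ L'] [FiniteDimensional ℝ L] [FiniteDimensional ℝ L']
    (π : L →ₗ⁅ℝ⁆ L') (hπ : ∀ v, π v = 0 → ∀ x : L, ⁅x, v⁆ = 0) (hs : Function.Surjective π)
    (h : IsUnimodular L) : IsUnimodular L' := by
  intro y
  obtain ⟨x, rfl⟩ := hs y
  -- With a linear section, ad (π x) = π ∘ ad x ∘ σ, while ad x ∘ σ ∘ π = ad x because the kernel is
  -- central; the trace is cyclic.
  obtain ⟨σ, hσ⟩ := (π : L →ₗ[ℝ] L').exists_rightInverse_of_surjective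
    (LinearMap.range_eq_top.mpr hs)
  have hσ' : ∀ v, π (σ v) = v := fun v => LinearMap.congr_fun hσ v
  have e1 : LieAlgebra.ad ℝ L' (π x) = (π : L →ₗ[ℝ] L') ∘ₗ (LieAlgebra.ad ℝ L x ∘ₗ σ) := by
    ext v
    simp [hσ']
  have e2 : (LieAlgebra.ad ℝ L x ∘ₗ σ) ∘ₗ (π : L →ₗ[ℝ] L') = LieAlgebra.ad ℝ L x := by
    ext v
    have := hπ (σ (π v) - v) (by rw [map_sub, hσ', sub_self]) x
    rw [lie_sub, sub_eq_zero] at this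
    simpa using this
  rw [e1, LinearMap.trace_comp_comm', e2]
  exact h x

-- The commutator bracket on ℝ is zero, so `L × ℝ` is the product with an abelian line.
attribute [local instance] LieRing.ofAssociativeRing


/-! ### Sasakian algebras: the Reeb vector and the Kähler quotient -/

namespace SasakianStructure

variable {L : Type u} [LieRing L] [LieAlgebra ℝ L] (S : SasakianStructure L)

theorem xi_ne_zero : S.ξ ≠ 0 := by
  intro h
  have := S.eta_xi
  rw [h, map_zero] at this
  exact zero_ne_one this

@[simp]
theorem phi_xi : S.φ S.ξ = 0 := by
  have h1 : S.φ (S.φ S.ξ) = 0 := by rw [S.phi_phi, S.eta_xi]; simp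
  have h2 := S.phi_phi (S.φ S.ξ)
  rw [h1, map_zero] at h2
  have h3 : S.φ S.ξ = S.η (S.φ S.ξ) • S.ξ := by
    rw [← sub_eq_zero, ← neg_eq_zero, h2]
    abel
  generalize S.η (S.φ S.ξ) = c at h3
  rw [h3, map_smul, h3, smul_smul] at h1
  have h4 := (smul_eq_zero.mp h1).resolve_right S.xi_ne_zero
  rw [h3, mul_self_eq_zero.mp h4, zero_smul]

@[simp]
theorem eta_phi (x : L) : S.η (S.φ x) = 0 := by
  have h1 := S.phi_phi (S.φ x)
  rw [S.phi_phi x, map_add, map_neg, map_smul, phi_xi, smul_zero, add_zero] at h1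
  exact (smul_eq_zero.mp (left_eq_add.mp h1)).resolve_right S.xi_ne_zero

theorem g_xi (x : L) : S.g x S.ξ = S.η x := by
  have := S.compatible x S.ξ
  rw [phi_xi, map_zero, S.eta_xi] at this
  linarith

theorem xi_g (x : L) : S.g S.ξ x = S.η x := by
  rw [S.inner_g.symm, g_xi]

theorem phi_skew (x y : L) : S.g (S.φ x) y = -S.g x (S.φ y) := by
  have := S.compatible x (S.φ y)
  rw [S.phi_phi, map_add, map_neg, map_smul, g_xi, eta_phi, eta_phi] at this
  simp only [smul_zero, mul_zero] at this
  linarith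

theorem eta_lie (x y : L) : S.η ⁅x, y⁆ = -(2 * S.g (S.φ x) y) := by
  rw [← S.contact, dOneForm, neg_neg]

theorem eq_smul_of_phi_eq_zero {x : L} (h : S.φ x = 0) : x = S.η x • S.ξ := by
  have := S.phi_phi x
  rw [h, map_zero] at this
  rw [← sub_eq_zero, ← neg_eq_zero, this]
  abel

@[simp]
theorem eta_xi_lie (x : L) : S.η ⁅S.ξ, x⁆ = 0 := by
  rw [eta_lie, phi_xi]
  simp

/-- Normality at ξ puts the difference of the two sides in ker φ = ℝξ, and η kills it. -/
theorem phi_xi_lie (x : L) : S.φ ⁅S.ξ, x⁆ = ⁅S.ξ, S.φ x⁆ := by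
  have h := S.normal S.ξ x
  rw [nijenhuis, phi_xi, zero_lie, zero_lie, zero_add, zero_add, dOneForm, eta_xi_lie, neg_zero,
    zero_smul, neg_zero, ← map_sub] at h
  have h1 := S.eq_smul_of_phi_eq_zero h
  rw [map_sub, eta_phi, eta_xi_lie, sub_zero, zero_smul] at h1
  exact sub_eq_zero.mp h1

/-- The Reeb vector is Killing. -/
theorem xi_lie_skew (x y : L) : S.g ⁅S.ξ, x⁆ y = -S.g x ⁅S.ξ, y⁆ := by
  -- The derivation ad ξ preserves dη; evaluating on (φx, y) turns dη into the metric.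
  have h : S.η ⁅⁅S.ξ, S.φ x⁆, y⁆ + S.η ⁅S.φ x, ⁅S.ξ, y⁆⁆ = 0 := by
    rw [← map_add, ← leibniz_lie, eta_xi_lie]
  rw [eta_lie, eta_lie, phi_xi_lie, S.phi_phi, lie_add, lie_neg, lie_smul, lie_self] at h
  simp only [smul_zero, add_zero, map_neg, LinearMap.neg_apply, map_add, LinearMap.add_apply,
    map_smul, LinearMap.smul_apply, xi_g, eta_xi_lie] at h
  linarith

/-- On a unimodular Lie algebra the Reeb vector is a combination of brackets, except in the
one-dimensional case. -/
theorem xi_mem_bracketSpan [FiniteDimensional ℝ L] (hu : IsUnimodular L) (hφ : S.φ ≠ 0) :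
    S.ξ ∈ bracketSpan ℝ L := by
  by_contra hξ
  obtain ⟨f, hf, hf0⟩ := Submodule.exists_le_ker_of_notMem hξ
  obtain ⟨ι, _, _, b, hb, -⟩ := S.inner_g.exists_basis ⊤
  -- If ξ were not a combination of brackets, there would be a closed 1-form `l` with `l ξ = 1`; `a`
  -- below is the metric dual of η - l.
  let l : L →ₗ[ℝ] ℝ := (f S.ξ)⁻¹ • f
  have hlξ : l S.ξ = 1 := inv_mul_cancel₀ hf
  have hl : ∀ x y, l ⁅x, y⁆ = 0 := fun x y => by
    have : f ⁅x, y⁆ = 0 := hf0 (lie_mem_bracketSpan ℝ x y)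
    simp [l, this]
  let a : L := ∑ i, (S.η (b i) - l (b i)) • b i
  have ha : ∀ y, S.g a y = S.η y - l y := by
    intro y
    conv_rhs => rw [← hb.sum_smul y]
    simp only [a, map_sum, map_smul, LinearMap.sum_apply, LinearMap.smul_apply, smul_eq_mul,
      ← Finset.sum_sub_distrib]
    refine Finset.sum_congr rfl fun i _ => ?_
    rw [S.inner_g.symm (b i) y]
    ring
  have haη : S.η a = 0 := by rw [← g_xi, ha, hlξ, S.eta_xi, sub_self]
  -- A Liouville-type vector, scaled so that η ∘ D = l - η. As `l` kills brackets, the derivation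
  -- `D` rescales dη by -1, which tracelessness allows only if φ = 0.
  let D : L →ₗ[ℝ] L := LieAlgebra.ad ℝ L ((-(1 / 2) : ℝ) • S.φ a)
  have hD : ∀ y, S.η (D y) = l y - S.η y := by
    intro y
    have : D y = ⁅(-(1 / 2) : ℝ) • S.φ a, y⁆ := rfl
    rw [this, eta_lie, map_smul, S.phi_phi, haη, zero_smul, add_zero]
    simp only [map_smul, map_neg, LinearMap.smul_apply, LinearMap.neg_apply, smul_eq_mul, ha]
    ring
  have hDlie : ∀ x y, D ⁅x, y⁆ = ⁅D x, y⁆ + ⁅x, D y⁆ := fun x y => leibniz_lie _ x y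
  have key : ∀ e, S.g (S.φ e) (S.φ e) =
      S.g (S.φ (D (S.φ e))) e - S.g (D e) e + S.g e S.ξ * S.η (D e) := by
    intro e
    have h1 := congrArg S.η (hDlie (S.φ e) e)
    rw [hD, hl, map_add, eta_lie, eta_lie, eta_lie, S.phi_phi] at h1
    have h2 : S.g (S.φ e) (S.φ e) = -S.g (S.φ (S.φ e)) e := by rw [S.phi_skew (S.φ e), neg_neg]
    rw [S.phi_phi] at h2
    simp only [map_neg, LinearMap.neg_apply, map_add, LinearMap.add_apply,
      map_smul, LinearMap.smul_apply, smul_eq_mul, xi_g, g_xi] at h1 h2 ⊢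
    rw [S.inner_g.symm e (D e)] at h1
    linarith
  have ht : LinearMap.trace ℝ L D = 0 := hu _
  have hDξ : S.η (D S.ξ) = 0 := by rw [hD, hlξ, S.eta_xi, sub_self]
  -- By cyclicity this is tr (Dφ²) = -tr D + η(Dξ), and both terms vanish.
  have h1 : ∑ i, S.g (S.φ (D (S.φ (b i)))) (b i) = 0 := by
    have e1 : LinearMap.trace ℝ L (S.φ ∘ₗ (D ∘ₗ S.φ)) =
        LinearMap.trace ℝ L ((D ∘ₗ S.φ) ∘ₗ S.φ) := LinearMap.trace_comp_comm' _ _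
    rw [hb.trace_eq, hb.trace_eq] at e1
    simp only [LinearMap.comp_apply, S.phi_phi] at e1
    rw [e1]
    rw [hb.trace_eq] at ht
    simp only [map_add, map_neg, map_smul, LinearMap.add_apply, LinearMap.neg_apply,
      LinearMap.smul_apply, smul_eq_mul, Finset.sum_add_distrib, Finset.sum_neg_distrib, ht]
    rw [neg_zero, zero_add, ← hDξ, ← g_xi, ← hb.sum_mul (D S.ξ) S.ξ]
    refine Finset.sum_congr rfl fun i _ => ?_
    rw [g_xi, mul_comm]
  have h2 : ∑ i, S.g (b i) S.ξ * S.η (D (b i)) = 0 := by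
    rw [← hDξ]
    conv_rhs => rw [← hb.sum_smul S.ξ]
    simp only [map_sum, map_smul, smul_eq_mul]
    refine Finset.sum_congr rfl fun i _ => ?_
    rw [S.inner_g.symm]
  have h3 : ∑ i, S.g (S.φ (b i)) (S.φ (b i)) = 0 := by
    simp only [key, Finset.sum_add_distrib, Finset.sum_sub_distrib, h1, h2]
    rw [← hb.trace_eq, ht]
    ring
  refine hφ (b.ext fun i => ?_)
  rw [LinearMap.zero_apply]
  have h4 := (Finset.sum_eq_zero_iff_of_nonneg fun i _ =>
    S.inner_g.self_nonneg (S.φ (b i))).mp h3 i (Finset.mem_univ _)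
  exact S.inner_g.eq_zero_of_self h4

/-- On a unimodular solvable Lie algebra the Reeb vector is central. -/
theorem xi_lie [FiniteDimensional ℝ L] [LieAlgebra.IsSolvable L] (hu : IsUnimodular L) (x : L) :
    ⁅S.ξ, x⁆ = 0 := by
  by_cases hφ : S.φ = 0
  · rw [S.eq_smul_of_phi_eq_zero (x := x) (by rw [hφ, LinearMap.zero_apply]), lie_smul, lie_self,
      smul_zero]
  · obtain ⟨ι, _, _, b, hb, -⟩ := S.inner_g.exists_basis ⊤
    have h := trace_ad_comp_ad_eq_zero (S.xi_mem_bracketSpan hu hφ)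
    rw [hb.trace_eq] at h
    simp only [LinearMap.comp_apply, LieAlgebra.ad_apply, xi_lie_skew S _ (b _),
      Finset.sum_neg_distrib, neg_eq_zero] at h
    have h0 : LieAlgebra.ad ℝ L S.ξ = 0 := b.ext fun i =>
      S.inner_g.eq_zero_of_self ((Finset.sum_eq_zero_iff_of_nonneg fun i _ =>
        S.inner_g.self_nonneg ⁅S.ξ, b i⁆).mp h i (Finset.mem_univ _))
    exact LinearMap.congr_fun h0 x

/-- Identifies the center with ker φ = ℝξ: for central v, 0 = η[v, φv] = -2 |φv|². -/
theorem phi_eq_zero_iff [FiniteDimensional ℝ L] [LieAlgebra.IsSolvable L] (hu : IsUnimodular L)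
    (v : L) : S.φ v = 0 ↔ ∀ x : L, ⁅x, v⁆ = 0 := by
  constructor
  · intro h x
    rw [S.eq_smul_of_phi_eq_zero h, lie_smul, ← lie_skew, S.xi_lie hu, neg_zero, smul_zero]
  · intro h
    refine S.inner_g.eq_zero_of_self ?_
    have := S.eta_lie v (S.φ v)
    rw [← lie_skew, h, neg_zero, map_zero] at this
    linarith

/-- The quotient of a Sasakian Lie algebra by the Reeb direction is Kähler. -/
theorem exists_isKahler {H : Type u} [LieRing H] [LieAlgebra ℝ H] (π : L →ₗ⁅ℝ⁆ H)
    (hs : Function.Surjective π) (hπ : ∀ v, π v = 0 ↔ S.φ v = 0) :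
    ∃ (g : H →ₗ[ℝ] H →ₗ[ℝ] ℝ) (J : H →ₗ[ℝ] H), IsKahler g J := by
  obtain ⟨σ, hσ⟩ := (π : L →ₗ[ℝ] H).exists_rightInverse_of_surjective
    (LinearMap.range_eq_top.mpr hs)
  have hσ' : ∀ v, π (σ v) = v := fun v => LinearMap.congr_fun hσ v
  have hφσ : ∀ x, S.φ (σ (π x)) = S.φ x := fun x => by
    rw [← sub_eq_zero, ← map_sub, ← hπ, map_sub, hσ', sub_self]
  -- The transverse metric g(φ·, φ·); it does not depend on the section because ker π = ker φ.
  let g : H →ₗ[ℝ] H →ₗ[ℝ] ℝ := S.g.compl₁₂ (S.φ ∘ₗ σ) (S.φ ∘ₗ σ)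
  let J : H →ₗ[ℝ] H := (π : L →ₗ[ℝ] H) ∘ₗ S.φ ∘ₗ σ
  have hg : ∀ x y, g (π x) (π y) = S.g (S.φ x) (S.φ y) := fun x y => by
    simp [g, hφσ]
  have hJ : ∀ x, J (π x) = π (S.φ x) := fun x => by
    simp [J, hφσ]
  have hξ : π S.ξ = 0 := (hπ _).mpr S.phi_xi
  refine ⟨g, J, ⟨fun x y => ?_, fun x hx => ?_⟩, fun x => ?_, fun x y => ?_, fun x y => ?_,
    fun x y z => ?_⟩
  · exact S.inner_g.symm _ _
  · obtain ⟨x, rfl⟩ := hs x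
    rw [hg]
    exact S.inner_g.pos _ fun h => hx ((hπ x).mpr h)
  · obtain ⟨x, rfl⟩ := hs x
    rw [hJ, hJ, S.phi_phi, map_add, map_smul, hξ, map_neg, smul_zero, add_zero]
  · obtain ⟨x, rfl⟩ := hs x
    obtain ⟨y, rfl⟩ := hs y
    rw [hJ, hJ, hg, hg, S.compatible (S.φ x), eta_phi, zero_mul, sub_zero]
  · obtain ⟨x, rfl⟩ := hs x
    obtain ⟨y, rfl⟩ := hs y
    have := congrArg π (S.normal x y)
    rw [map_neg, map_smul, hξ, smul_zero, neg_zero] at this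
    rw [← this]
    simp only [nijenhuis, hJ, ← LieHom.map_lie, ← map_add, ← map_sub]
  · obtain ⟨x, rfl⟩ := hs x
    obtain ⟨y, rfl⟩ := hs y
    obtain ⟨z, rfl⟩ := hs z
    -- The Kähler form pulls back to ½ dη, so its closedness is the Jacobi identity.
    have e : ∀ x y, (g ∘ₗ J) (π x) (π y) = -(1 / 2) * S.η ⁅x, y⁆ := fun x y => by
      rw [LinearMap.comp_apply, hJ, hg, S.compatible (S.φ x), eta_phi, eta_lie]
      ring
    have j := congrArg S.η (lie_jacobi x y z)
    rw [← lie_skew x ⁅y, z⁆, ← lie_skew y ⁅z, x⁆, ← lie_skew z ⁅x, y⁆] at j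
    simp only [map_add, map_neg, map_zero] at j
    simp only [dTwoForm, ← LieHom.map_lie, e]
    linarith

theorem hasImaginarySpectrum [FiniteDimensional ℝ L] [LieAlgebra.IsSolvable L]
    (S : SasakianStructure L) (hu : IsUnimodular L) (x : L) : HasImaginarySpectrum (LieAlgebra.ad ℝ L x) := by
  let I := LieAlgebra.center ℝ L
  let π : L →ₗ⁅ℝ⁆ L ⧸ I :=
    { (LieSubmodule.Quotient.mk' I : L →ₗ[ℝ] L ⧸ I) with
      map_lie' := fun {x y} => LieSubmodule.Quotient.mk_bracket (I := I) x y }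
  have hs : Function.Surjective π := LieSubmodule.Quotient.surjective_mk' I
  have hπ : ∀ v, π v = 0 ↔ ∀ x : L, ⁅x, v⁆ = 0 := fun v =>
    (LieSubmodule.Quotient.mk_eq_zero (N := I)).trans (LieModule.mem_maxTrivSubmodule ℝ L L v)
  have : FiniteDimensional ℝ (L ⧸ I) := inferInstanceAs (FiniteDimensional ℝ (L ⧸ I.toSubmodule))
  have : LieAlgebra.IsSolvable (L ⧸ I) := hs.lieAlgebra_isSolvable
  obtain ⟨g, J, h⟩ := S.exists_isKahler π hs fun v => (hπ v).trans (S.phi_eq_zero_iff hu v).symm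
  exact hasImaginarySpectrum_of_hom π (fun v hv => (hπ v).mp hv)
    (h.hasImaginarySpectrum (hu.of_surjective π (fun v hv => (hπ v).mp hv) hs)) x

/-! ### The Vaisman structure on the product with a line -/

/-- The product of a Sasakian Lie algebra having central Reeb vector with a line is Vaisman. -/
theorem nonempty_vaismanStructure_prod [FiniteDimensional ℝ L] (hξ : ∀ x : L, ⁅S.ξ, x⁆ = 0) :
    Nonempty (VaismanStructure (L × ℝ)) := by
  let g : L × ℝ →ₗ[ℝ] L × ℝ →ₗ[ℝ] ℝ :=
    S.g.compl₁₂ (LinearMap.fst ℝ L ℝ) (LinearMap.fst ℝ L ℝ) +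
      (LinearMap.mul ℝ ℝ).compl₁₂ (LinearMap.snd ℝ L ℝ) (LinearMap.snd ℝ L ℝ)
  let J : L × ℝ →ₗ[ℝ] L × ℝ :=
    (S.φ ∘ₗ LinearMap.fst ℝ L ℝ - (LinearMap.snd ℝ L ℝ).smulRight S.ξ).prod
      (S.η ∘ₗ LinearMap.fst ℝ L ℝ)
  have hg : ∀ x y, g x y = S.g x.1 y.1 + x.2 * y.2 := fun x y => rfl
  have hJ : ∀ x, J x = (S.φ x.1 - x.2 • S.ξ, S.η x.1) := fun x => rfl
  have hξ' : ∀ x : L, ⁅x, S.ξ⁆ = 0 := fun x => by rw [← lie_skew, hξ, neg_zero]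
  have hb : ∀ x y : L × ℝ, ⁅x, y⁆ = (⁅x.1, y.1⁆, (0 : ℝ)) := fun x y => by
    rw [LieAlgebra.Prod.bracket_apply, LieRing.of_associative_ring_bracket, mul_comm, sub_self]
  have hω : ∀ x y, (g ∘ₗ J) x y = -(1 / 2) * S.η ⁅x.1, y.1⁆ - x.2 * S.η y.1 + S.η x.1 * y.2 := by
    intro x y
    rw [LinearMap.comp_apply, hJ, hg, eta_lie]
    simp only [map_sub, map_smul, LinearMap.sub_apply, LinearMap.smul_apply, xi_g, smul_eq_mul]
    ring
  have hinner : IsInnerProduct g := by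
    refine ⟨fun x y => ?_, fun x hx => ?_⟩
    · rw [hg, hg, S.inner_g.symm, mul_comm]
    · rw [hg]
      by_cases h1 : x.1 = 0
      · have h2 : x.2 ≠ 0 := fun h => hx (Prod.ext h1 h)
        rw [h1, map_zero, zero_add]
        exact mul_self_pos.mpr h2
      · have := S.inner_g.pos _ h1
        nlinarith [mul_self_nonneg x.2]
  -- With t the last coordinate, ω = ½ dη + η ∧ dt, so dω = dη ∧ dt = 2dt ∧ ω: hence the factor 2 in
  -- the Lee form.
  refine ⟨⟨J, g, (2 : ℝ) • LinearMap.snd ℝ L ℝ, hinner, fun x => ?_, fun x y => ?_, fun x y => ?_,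
    fun h => ?_, fun x y => ?_, fun x y z => ?_, ?_⟩⟩
  · simp only [hJ, map_sub, map_smul, S.phi_phi, phi_xi, eta_phi, S.eta_xi]
    ext <;> simp
  · have h := S.normal x.1 y.1
    have e : S.η ⁅S.φ x.1, y.1⁆ + S.η ⁅x.1, S.φ y.1⁆ = 0 := by
      rw [eta_lie, eta_lie, S.phi_skew (S.φ x.1)]
      ring
    simp only [nijenhuis, dOneForm, neg_smul, neg_neg, S.phi_phi] at h
    simp only [nijenhuis, hJ, hb, sub_lie, lie_sub, smul_lie, lie_smul, hξ, hξ', smul_zero,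
      sub_zero, zero_smul, Prod.mk_add_mk, add_zero, map_add, eta_phi, S.phi_phi, e]
    ext
    · simp only [Prod.fst_sub, Prod.fst_zero]
      rw [map_add] at h
      have h' := sub_eq_zero.mpr h
      rw [← h']
      abel
    · simp
  · rw [hg, hg, hJ, hJ]
    simp only [map_sub, map_smul, LinearMap.sub_apply, LinearMap.smul_apply, S.compatible, xi_g,
      g_xi, eta_phi, S.eta_xi, smul_eq_mul]
    ring
  · have := LinearMap.congr_fun h ((0 : L), (1 : ℝ))
    simp at this
  · rw [dOneForm, hb]
    simp
  · have j := congrArg S.η (lie_jacobi x.1 y.1 z.1)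
    rw [← lie_skew x.1 ⁅y.1, z.1⁆, ← lie_skew y.1 ⁅z.1, x.1⁆, ← lie_skew z.1 ⁅x.1, y.1⁆] at j
    simp only [map_add, map_neg, map_zero] at j
    simp only [dTwoForm, wedgeOneTwo, hω, hb, LinearMap.smul_apply, LinearMap.snd_apply,
      smul_eq_mul]
    linear_combination (-1 / 2) * j
  -- The vector `(0, 1)` is central and orthogonal to all brackets, so every term of Koszul's
  -- formula against it vanishes.
  · obtain ⟨nab, hn, hk⟩ := hinner.exists_leviCivita
    refine ⟨nab, hn, fun x y => ?_⟩
    have := hk x y (0, 1)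
    simp only [koszulForm, hb, hg, lie_zero, zero_lie, map_zero, LinearMap.zero_apply] at this
    simp only [LinearMap.smul_apply, LinearMap.snd_apply, smul_eq_mul]
    simpa using this

end SasakianStructure

theorem isSolvable_prod_real {L : Type u} [LieRing L] [LieAlgebra ℝ L]
    [hL : LieAlgebra.IsSolvable L] : LieAlgebra.IsSolvable (L × ℝ) := by
  rw [LieAlgebra.isSolvable_iff ℝ] at hL ⊢
  obtain ⟨k, hk⟩ := hL
  have h1 := LieIdeal.derivedSeries_map_le (f := LieHom.fst ℝ L ℝ) k
  -- The `k`-th derived ideal projects to zero in `L`, so it lies in the abelian line; one more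
  -- bracket kills it.
  refine ⟨k + 1, ?_⟩
  rw [LieAlgebra.derivedSeries_def, LieAlgebra.derivedSeriesOfIdeal_succ,
    LieSubmodule.lie_eq_bot_iff]
  intro x hx y hy
  have hx1 : x.1 = 0 := by
    have : LieHom.fst ℝ L ℝ x ∈ (⊥ : LieIdeal ℝ L) :=
      hk ▸ h1 (LieIdeal.mem_map hx)
    simpa using this
  rw [LieAlgebra.Prod.bracket_apply, LieRing.of_associative_ring_bracket, mul_comm, sub_self, hx1,
    zero_lie]
  rfl

theorem IsUnimodular.prod_real {L : Type u} [LieRing L] [LieAlgebra ℝ L] [FiniteDimensional ℝ L]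
    (h : IsUnimodular L) : IsUnimodular (L × ℝ) := by
  intro x
  have : LieAlgebra.ad ℝ (L × ℝ) x = (LieAlgebra.ad ℝ L x.1).prodMap 0 := by
    ext y <;> simp [LieAlgebra.Prod.bracket_apply, LieRing.of_associative_ring_bracket, mul_comm]
  rw [this, LinearMap.trace_prodMap', h, map_zero, add_zero]

theorem mainTheorem9 {𝔰 : Type u} [LieRing 𝔰] [LieAlgebra ℝ 𝔰] [FiniteDimensional ℝ 𝔰]
    (hsolv : LieAlgebra.IsSolvable 𝔰) (hunim : IsUnimodular 𝔰)
    (hsas : Nonempty (SasakianStructure 𝔰)) :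
    IsTypeI 𝔰 ∧
      ∃ (𝔤 : Type u) (_ : LieRing 𝔤) (_ : LieAlgebra ℝ 𝔤) (_ : FiniteDimensional ℝ 𝔤)
        (ι : 𝔰 →ₗ⁅ℝ⁆ 𝔤),
        Function.Injective ι ∧
        Module.finrank ℝ 𝔤 = Module.finrank ℝ 𝔰 + 1 ∧
        LieAlgebra.IsSolvable 𝔤 ∧
        IsUnimodular 𝔤 ∧
        Nonempty (VaismanStructure 𝔤) ∧
        IsTypeI 𝔤 := by
  obtain ⟨S⟩ := hsas
  have hspec := S.hasImaginarySpectrum hunim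
  refine ⟨isTypeI_of_hasImaginarySpectrum hspec, 𝔰 × ℝ, inferInstance, inferInstance,
    inferInstance, LieHom.inl ℝ 𝔰 ℝ, LieHom.inl_injective, by simp,
    isSolvable_prod_real, hunim.prod_real, S.nonempty_vaismanStructure_prod (S.xi_lie hunim),
    isTypeI_of_hasImaginarySpectrum
      (hasImaginarySpectrum_of_hom (LieHom.fst ℝ 𝔰 ℝ) (fun v hv x => ?_) hspec)⟩
  have hv1 : v.1 = 0 := hv
  rw [LieAlgebra.Prod.bracket_apply, LieRing.of_associative_ring_bracket, mul_comm, sub_self, hv1,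
    lie_zero]
  rfl
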